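/- For a topological space $X$, a subset $A\subseteq X$ and $n\ge 0$, let $\check H^n(X,A)$ denote the integral Alexander–Spanier cohomology of the pair: the $n$-th cohomology of the cochain complex $C^*(X,A)/C^*_0(X)$ with the usual alternating coboundary, where $C^n_0(X)$ is the group of functions $X^{n+1}\to\mathbb Z$ that are locally zero, i.e. vanish on all $(n+1)$-tuples lying in a single member of some open cover of $X$, and $C^n(X,A)$ is the group of functions $X^{n+1}\to\mathbb Z$ whose restriction to $A^{n+1}$ is locally zero on $A$. **Lemma 2.3.** Let $Z$ be a compact metric space, $A$ a closed subset of $Z$ and $n\ge 0$ an integer. Assume that $\check H^n(Z,A)\neq 0$ and that $\check H^{n+1}(Z,B)=0$ for every closed subset $B$ of $Z$. Then there are an integer $k_0\ge 1$, a number $\delta>0$ and a sequence of open balls $\{B_k\}_{k\ge k_0}$ of $Z$, contained in $Z\setminus A$, with $B_k$ of radius $1/k$, such that for every $k\ge k_0$ one has $d_Z(x,a)\ge\delta$ for all $x\in B_k$ and $a\in A$, and the homomorphism $\check H^n(Z,Z\setminus B_k)\to\check H^n(Z,A)$ induced by the inclusion $(Z,A)\hookrightarrow(Z,Z\setminus B_k)$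 is non-zero. -/

import Mathlib

open Topology

/-! Integral Alexander–Spanier cohomology of a pair `(X, A)`, where `A` is a subset of the
topological space `X`.

The Alexander–Spanier cochain complex of the pair is
`C^*(X, A) / C_0^*(X)`, where `C^n(X, A)` consists of all functions `φ : X ^ (n + 1) → ℤ`
(no continuity is required) whose restriction to `A` is locally zero, and `C_0^n(X)` consists of
the locally zero functions on `X`.  This is the kernel of the restriction map
`C^*(X) / C_0^*(X) → C^*(A) / C_0^*(A)`. -/
namespace AlexanderSpanier

/-- The (Alexander–Spanier) coboundary
`(δ φ)(x₀, …, x_{m}) = ∑ i, (-1) ^ i φ(x₀, …, x̂_i, …, x_{m})`. -/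
def coboundary {X : Type*} (m : ℕ) :
    ((Fin m → X) → ℤ) →+ ((Fin (m + 1) → X) → ℤ) where
  toFun φ s := ∑ i : Fin (m + 1), (-1) ^ (i : ℕ) * φ (fun j => s (i.succAbove j))
  map_zero' := by
    funext s
    simp
  map_add' φ ψ := by
    funext s
    simp [mul_add, Finset.sum_add_distrib]

theorem coboundary_apply {X : Type*} (m : ℕ) (φ : (Fin m → X) → ℤ) (s : Fin (m + 1) → X) :
    coboundary m φ s = ∑ i : Fin (m + 1), (-1) ^ (i : ℕ) * φ (fun j => s (i.succAbove j)) :=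
  rfl

/-- The functions of `m` variables in `X` whose restriction to the subspace `A` is locally zero:
there are open sets covering `A` such that the function vanishes on every tuple of points of `A`
all of which lie in a single one of these open sets. -/
def locallyZeroOn {X : Type*} [TopologicalSpace X] (m : ℕ) (A : Set X) :
    AddSubgroup ((Fin m → X) → ℤ) where
  carrier := {φ | ∀ a ∈ A, ∃ U ∈ 𝓝 a, ∀ s : Fin m → X, (∀ i, s i ∈ U ∩ A) → φ s = 0}
  zero_mem' := fun _ _ => ⟨Set.univ, Filter.univ_mem, fun _ _ => rfl⟩
  add_mem' := by
    intro φ ψ hφ hψ a ha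
    obtain ⟨U, hU, hU'⟩ := hφ a ha
    obtain ⟨V, hV, hV'⟩ := hψ a ha
    refine ⟨U ∩ V, Filter.inter_mem hU hV, fun s hs => ?_⟩
    have h1 := hU' s (fun i => ⟨(hs i).1.1, (hs i).2⟩)
    have h2 := hV' s (fun i => ⟨(hs i).1.2, (hs i).2⟩)
    simp [h1, h2]
  neg_mem' := by
    intro φ hφ a ha
    obtain ⟨U, hU, hU'⟩ := hφ a ha
    exact ⟨U, hU, fun s hs => by simp [hU' s hs]⟩

theorem locallyZeroOn_anti {X : Type*} [TopologicalSpace X] (m : ℕ) {A B : Set X} (h : A ⊆ B) :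
    locallyZeroOn m B ≤ locallyZeroOn m A := by
  intro φ hφ a ha
  obtain ⟨U, hU, hU'⟩ := hφ a (h ha)
  exact ⟨U, hU, fun s hs => hU' s (fun i => ⟨(hs i).1, h (hs i).2⟩)⟩

/-- Representatives of the degree `n` cocycles of the pair `(X, A)`: functions of `n + 1`
variables, locally zero on `A`, whose coboundary is locally zero on `X`. -/
def cocycles {X : Type*} [TopologicalSpace X] (n : ℕ) (A : Set X) :
    AddSubgroup ((Fin (n + 1) → X) → ℤ) :=
  locallyZeroOn (n + 1) A ⊓ (locallyZeroOn (n + 2) Set.univ).comap (coboundary (n + 1))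

/-- Representatives of the degree `n` coboundaries of the pair `(X, A)`: locally zero functions
on `X` in degree `0` (there are no cochains in degree `-1`), and sums of a locally zero function
on `X` and the coboundary of a degree `n` cochain of `(X, A)` in degree `n + 1`. -/
def coboundaries {X : Type*} [TopologicalSpace X] :
    (n : ℕ) → (A : Set X) → AddSubgroup ((Fin (n + 1) → X) → ℤ)
  | 0, _ => locallyZeroOn 1 Set.univ
  | n + 1, A => locallyZeroOn (n + 2) Set.univ ⊔ (locallyZeroOn (n + 1) A).map (coboundary (n + 1))

theorem cocycles_anti {X : Type*} [TopologicalSpace X] (n : ℕ) {A B : Set X} (h : A ⊆ B) :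
    cocycles n B ≤ cocycles n A :=
  inf_le_inf_right _ (locallyZeroOn_anti _ h)

theorem coboundaries_anti {X : Type*} [TopologicalSpace X] (n : ℕ) {A B : Set X} (h : A ⊆ B) :
    coboundaries n B ≤ coboundaries n A := by
  cases n with
  | zero => exact le_refl _
  | succ n => exact sup_le_sup_left (AddSubgroup.map_mono (locallyZeroOn_anti _ h)) _

/-- The coboundary of a locally zero function is locally zero. -/
theorem coboundary_mem_locallyZeroOn {X : Type*} [TopologicalSpace X] (m : ℕ) {A : Set X}
    {φ : (Fin m → X) → ℤ} (hφ : φ ∈ locallyZeroOn m A) :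
    coboundary m φ ∈ locallyZeroOn (m + 1) A := by
  intro a ha
  obtain ⟨U, hU, hU'⟩ := hφ a ha
  refine ⟨U, hU, fun s hs => ?_⟩
  rw [coboundary_apply]
  exact Finset.sum_eq_zero fun i _ => by rw [hU' _ (fun j => hs _), mul_zero]

theorem coboundary_coboundary {X : Type*} (m : ℕ) (φ : (Fin m → X) → ℤ) :
    coboundary (m + 1) (coboundary m φ) = 0 := by
  funext s
  simp only [coboundary_apply, Finset.mul_sum, Pi.zero_apply]
  rw [← Finset.sum_product', Finset.univ_product_univ]
  refine Finset.sum_involution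
    (fun p _ => (p.1.succAbove p.2, p.2.predAbove p.1)) ?_ ?_ (fun _ _ => Finset.mem_univ _) ?_
  · rintro ⟨i, j⟩ -
    simp only [← mul_assoc, ← pow_add, Fin.neg_one_pow_succAbove_add_predAbove,
      Fin.succAbove_succAbove_succAbove_predAbove]
    ring
  · rintro ⟨i, j⟩ - - h
    exact Fin.succAbove_ne i j (congrArg Prod.fst h)
  · rintro ⟨i, j⟩ -
    simp [Fin.succAbove_succAbove_predAbove, Fin.predAbove_predAbove_succAbove]

/-- Coboundaries are cocycles, so that the quotient below is cocycles modulo coboundaries. -/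
theorem coboundaries_le_cocycles {X : Type*} [TopologicalSpace X] (n : ℕ) (A : Set X) :
    coboundaries n A ≤ cocycles n A := by
  have key : ∀ m, locallyZeroOn (m + 1) Set.univ ≤ cocycles m A := fun m φ hφ =>
    ⟨locallyZeroOn_anti _ (Set.subset_univ A) hφ, coboundary_mem_locallyZeroOn _ hφ⟩
  cases n with
  | zero => exact key 0
  | succ n =>
    refine sup_le (key _) ?_
    rintro _ ⟨ψ, hψ, rfl⟩
    refine ⟨coboundary_mem_locallyZeroOn _ hψ, ?_⟩
    change coboundary (n + 2) (coboundary (n + 1) ψ) ∈ locallyZeroOn (n + 3) Set.univ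
    rw [coboundary_coboundary]
    exact zero_mem _

/-- The integral Alexander–Spanier cohomology group `H^n(X, A)`. -/
abbrev Cohomology {X : Type*} [TopologicalSpace X] (n : ℕ) (A : Set X) : Type _ :=
  cocycles n A ⧸ (coboundaries n A).addSubgroupOf (cocycles n A)

/-- The homomorphism `H^n(X, B) → H^n(X, A)` induced by the inclusion of pairs
`(X, A) → (X, B)`, for `A ⊆ B`: it sends the class of a cocycle to the class of the same
cocycle. -/
def Cohomology.map {X : Type*} [TopologicalSpace X] (n : ℕ) {A B : Set X} (h : A ⊆ B) :
    Cohomology n B →+ Cohomology n A :=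
  QuotientAddGroup.map _ _ (AddSubgroup.inclusion (cocycles_anti n h))
    (fun _ hx => coboundaries_anti n h hx)

end AlexanderSpanier

/-! A nonzero class of `(Z, A)` comes from some thickening of `A` (tautness,
`exists_cocycle_thickening`). If, for some radius, every ball centred off that thickening induced
the zero map, finitely many of them would cover the compact complement. Vanishing of degree `n + 1`
makes the relative Mayer–Vietoris map onto degree `n` of `(Z, B₁ ∩ B₂)` surjective, so zero maps
from `B₁` and `B₂` force a zero map from `B₁ ∩ B₂` (`cocycles_inter_le_coboundaries`). By finite
induction the intersection of the ball complements, which lies in the thickening, would also induce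
zero, killing the class. Everything is phrased on representatives: a map is zero iff cocycles of the
source are coboundaries of the target. -/

namespace AlexanderSpanier

variable {X : Type*}

/-! ### The prism homotopy -/

theorem coboundary_cons (m : ℕ) (φ : (Fin (m + 1) → X) → ℤ) (x : X) (s : Fin (m + 1) → X) :
    coboundary (m + 1) φ (Fin.cons x s : Fin (m + 2) → X) =
      φ s - coboundary m (fun t => φ (Fin.cons x t : Fin (m + 1) → X)) s := by
  rw [coboundary_apply, Fin.sum_univ_succ, coboundary_apply, sub_eq_add_neg,
    ← Finset.sum_neg_distrib]
  congr 1
  · simp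
  · refine Finset.sum_congr rfl fun i _ => ?_
    have : (fun j => (Fin.cons x s : Fin (m + 2) → X) (i.succ.succAbove j)) =
        (Fin.cons x (fun j => s (i.succAbove j)) : Fin (m + 1) → X) := by
      funext j
      refine Fin.cases ?_ (fun j => ?_) j <;> simp
    rw [this, Fin.val_succ, pow_succ]
    ring

/-- The chain homotopy between the identity and the map induced by `f`:
`(x₀, …, x_{m-1}) ↦ ∑ i, (-1) ^ i φ(x₀, …, x_i, f x_i, …, f x_{m-1})`. -/
def prism (f : X → X) : (m : ℕ) → ((Fin (m + 1) → X) → ℤ) → (Fin m → X) → ℤ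
  | 0, _, _ => 0
  | m + 1, φ, s => φ (Fin.cons (s 0) (f ∘ s)) -
      prism f m (fun t => φ (Fin.cons (s 0) t)) (Fin.tail s)

theorem prism_sub (f : X → X) (m : ℕ) (φ ψ : (Fin (m + 1) → X) → ℤ) (s : Fin m → X) :
    prism f m (fun t => φ t - ψ t) s = prism f m φ s - prism f m ψ s := by
  induction m with
  | zero => simp [prism]
  | succ m ih =>
    simp only [prism]
    rw [ih (fun t => φ (Fin.cons (s 0) t)) (fun t => ψ (Fin.cons (s 0) t))]
    ring

theorem comp_cons (f : X → X) (m : ℕ) (x : X) (s : Fin m → X) :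
    f ∘ (Fin.cons x s : Fin (m + 1) → X) = (Fin.cons (f x) (f ∘ s) : Fin (m + 1) → X) := by
  funext j
  refine Fin.cases ?_ (fun j => ?_) j <;> simp

theorem prism_cons (f : X → X) (m : ℕ) (φ : (Fin (m + 2) → X) → ℤ) (x : X) (s : Fin m → X) :
    prism f (m + 1) φ (Fin.cons x s : Fin (m + 1) → X) =
      φ (Fin.cons x (Fin.cons (f x) (f ∘ s) : Fin (m + 1) → X)) -
        prism f m (fun t => φ (Fin.cons x t)) s := by
  simp only [prism, comp_cons, Fin.cons_zero, Fin.tail_cons]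

theorem coboundary_comp (f : X → X) (m : ℕ) (φ : (Fin m → X) → ℤ) (s : Fin (m + 1) → X) :
    coboundary m (fun t => φ (f ∘ t)) s = coboundary m φ (f ∘ s) :=
  rfl

/-- Splitting off the first vertex `x` reduces the identity to the one for `φ(x, ·)`. No continuity
of `f` is needed. -/
theorem prism_coboundary_add (f : X → X) (m : ℕ) (φ : (Fin (m + 1) → X) → ℤ)
    (s : Fin (m + 1) → X) :
    prism f (m + 1) (coboundary (m + 1) φ) s + coboundary m (prism f m φ) s =
      φ (f ∘ s) - φ s := by
  induction m with
  | zero =>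
    obtain ⟨x, s, rfl⟩ : ∃ x t, s = Fin.cons x t := ⟨_, _, (Fin.cons_self_tail s).symm⟩
    rw [prism_cons, coboundary_cons, comp_cons, coboundary_apply]
    simp only [prism, coboundary_apply]
    simp
    exact congrArg (fun t => φ (Fin.cons x t)) (Subsingleton.elim _ _)
  | succ m ih =>
    obtain ⟨x, s, rfl⟩ : ∃ x t, s = Fin.cons x t := ⟨_, _, (Fin.cons_self_tail s).symm⟩
    have hφ : (fun t => coboundary (m + 2) φ (Fin.cons x t : Fin (m + 3) → X)) =
        fun t => φ t - coboundary (m + 1) (fun t => φ (Fin.cons x t)) t := by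
      funext t
      rw [coboundary_cons]
    have hp : (fun t => prism f (m + 1) φ (Fin.cons x t : Fin (m + 1) → X)) =
        (fun t => φ (Fin.cons x (Fin.cons (f x) (f ∘ t) : Fin (m + 1) → X))) -
          prism f m (fun t => φ (Fin.cons x t)) := by
      funext t
      rw [prism_cons]
      rfl
    have hc := coboundary_comp f m (fun t => φ (Fin.cons x (Fin.cons (f x) t : Fin (m + 1) → X))) s
    have h := ih (fun t => φ (Fin.cons x t)) s
    rw [prism_cons, coboundary_cons (m + 1), coboundary_cons m, coboundary_cons m, hφ, hp,
      prism_sub, map_sub, Pi.sub_apply, hc, comp_cons]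
    linarith

/-- The prism operator does not leave a set containing the points of a tuple and their images. -/
theorem prism_eq_zero (f : X → X) (m : ℕ) (φ : (Fin (m + 1) → X) → ℤ) (T : Set X)
    (hφ : ∀ t, (∀ i, t i ∈ T) → φ t = 0) (s : Fin m → X) (hs : ∀ i, s i ∈ T)
    (hfs : ∀ i, f (s i) ∈ T) : prism f m φ s = 0 := by
  induction m with
  | zero => rfl
  | succ m ih =>
    have hcons : ∀ t : Fin (m + 1) → X, (∀ i, t i ∈ T) →
        φ (Fin.cons (s 0) t : Fin (m + 2) → X) = 0 := fun t ht =>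
      hφ _ fun i => Fin.cases (by simpa using hs 0) (fun j => by simpa using ht j) i
    simp only [prism]
    rw [hcons (f ∘ s) hfs, ih _ hcons (Fin.tail s) (fun i => hs i.succ) (fun i => hfs i.succ), sub_zero]

/-! ### Tautness -/

theorem locallyZeroOn_univ_le_coboundaries [TopologicalSpace X] (n : ℕ) (A : Set X) :
    locallyZeroOn (n + 1) Set.univ ≤ coboundaries n A := by
  cases n with
  | zero => exact le_rfl
  | succ n => exact le_sup_left

theorem comp_sub_mem_coboundaries [TopologicalSpace X] {n : ℕ} {A : Set X}
    {φ : (Fin (n + 1) → X) → ℤ} (f : X → X)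
    (h₁ : prism f (n + 1) (coboundary (n + 1) φ) ∈ locallyZeroOn (n + 1) Set.univ)
    (h₂ : prism f n φ ∈ locallyZeroOn n A) :
    (fun s => φ (f ∘ s)) - φ ∈ coboundaries n A := by
  have h : (fun s => φ (f ∘ s)) - φ =
      prism f (n + 1) (coboundary (n + 1) φ) + coboundary n (prism f n φ) :=
    funext fun s => (prism_coboundary_add f n φ s).symm
  rw [h]
  refine add_mem (locallyZeroOn_univ_le_coboundaries n A h₁) ?_
  cases n with
  | zero =>
    rw [show prism f 0 φ = 0 from rfl, map_zero]
    exact zero_mem _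
  | succ n => exact AddSubgroup.mem_sup_right ⟨_, h₂, rfl⟩

theorem exists_uniform_of_mem_locallyZeroOn [PseudoMetricSpace X] {m : ℕ} {A : Set X}
    (hA : IsCompact A) {φ : (Fin m → X) → ℤ} (hφ : φ ∈ locallyZeroOn m A) :
    ∃ ε > 0, ∀ x ∈ A, ∀ s : Fin m → X, (∀ i, s i ∈ Metric.ball x ε ∩ A) → φ s = 0 := by
  choose! U hU hU' using hφ
  obtain ⟨ε, hε, h⟩ := lebesgue_number_lemma_of_metric (c := fun a : A => interior (U a)) hA
    (fun _ => isOpen_interior)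
    (fun a ha => Set.mem_iUnion.2 ⟨⟨a, ha⟩, mem_interior_iff_mem_nhds.2 (hU a ha)⟩)
  refine ⟨ε, hε, fun x hx s hs => ?_⟩
  obtain ⟨a, ha⟩ := h x hx
  exact hU' a a.2 s fun i => ⟨interior_subset (ha (hs i).1), (hs i).2⟩

/-- Tautness: a cohomology class of `(X, A)` comes from a neighbourhood of `A`. -/
theorem exists_cocycle_thickening [PseudoMetricSpace X] [CompactSpace X] {n : ℕ} {A : Set X}
    (hA : IsClosed A) {φ : (Fin (n + 1) → X) → ℤ} (hφ : φ ∈ cocycles n A) :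
    ∃ r > 0, ∃ ψ ∈ cocycles n (Metric.thickening r A), ψ - φ ∈ coboundaries n A := by
  classical
  obtain ⟨hφA, hδφ⟩ := hφ
  obtain ⟨ε₁, hε₁, h₁⟩ := exists_uniform_of_mem_locallyZeroOn hA.isCompact hφA
  obtain ⟨ε₂, hε₂, h₂⟩ := exists_uniform_of_mem_locallyZeroOn isCompact_univ
    (show coboundary (n + 1) φ ∈ locallyZeroOn (n + 2) Set.univ from hδφ)
  -- If `y` is within `r` of `x`, then `f y` is within `2 * r` of `x` and `3 * r` of `f x`.
  obtain ⟨r, hr, hr₁, hr₂⟩ : ∃ r > 0, 3 * r ≤ ε₁ ∧ 2 * r ≤ ε₂ :=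
    ⟨min ε₁ ε₂ / 3, by positivity, by linarith [min_le_left ε₁ ε₂],
      by linarith [min_le_right ε₁ ε₂]⟩
  -- A possibly discontinuous retraction of the thickening onto `A`; small displacement is all that
  -- the homotopy requires.
  obtain ⟨f, hfA, hfr, hfd⟩ : ∃ f : X → X, (∀ x ∈ A, f x = x) ∧
      (∀ x ∈ Metric.thickening r A, f x ∈ A) ∧ ∀ x, dist (f x) x < r := by
    have : ∀ x, ∃ y, (x ∈ A → y = x) ∧ (x ∈ Metric.thickening r A → y ∈ A) ∧ dist y x < r := by
      intro x
      by_cases hx : x ∈ A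
      · exact ⟨x, fun _ => rfl, fun _ => hx, by simpa using hr⟩
      by_cases hx' : x ∈ Metric.thickening r A
      · obtain ⟨y, hy, hxy⟩ := Metric.mem_thickening_iff.1 hx'
        exact ⟨y, fun h => absurd h hx, fun _ => hy, by rwa [dist_comm]⟩
      · exact ⟨x, fun _ => rfl, fun h => absurd h hx', by simpa using hr⟩
    choose f hf using this
    exact ⟨f, fun x => (hf x).1, fun x => (hf x).2.1, fun x => (hf x).2.2⟩
  have hball : ∀ x y, y ∈ Metric.ball x r → f y ∈ Metric.ball x (2 * r) := fun x y hy => by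
    rw [Metric.mem_ball] at hy ⊢
    linarith [dist_triangle (f y) y x, hfd y]
  refine ⟨r, hr, fun s => φ (f ∘ s), ⟨?_, ?_⟩, comp_sub_mem_coboundaries f ?_ ?_⟩
  · refine fun x hx => ⟨_, Metric.ball_mem_nhds x hr, fun s hs => h₁ (f x) (hfr x hx) _ fun i =>
      ⟨?_, hfr _ (hs i).2⟩⟩
    have := hball x _ (hs i).1
    rw [Metric.mem_ball] at this ⊢
    linarith [dist_triangle (f (s i)) x (f x), hfd x, dist_comm x (f x),
      show dist ((f ∘ s) i) (f x) = dist (f (s i)) (f x) from rfl]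
  · refine fun x hx => ⟨_, Metric.ball_mem_nhds x hr, fun s hs => ?_⟩
    rw [coboundary_comp]
    exact h₂ x hx _ fun i =>
      ⟨Metric.ball_subset_ball hr₂ (hball x _ (hs i).1), Set.mem_univ _⟩
  · refine fun x hx => ⟨_, Metric.ball_mem_nhds x hr, fun s hs => ?_⟩
    refine prism_eq_zero f _ _ (Metric.ball x ε₂)
      (fun t ht => h₂ x hx t fun i => ⟨ht i, Set.mem_univ _⟩) s (fun i => ?_)
      (fun i => Metric.ball_subset_ball hr₂ (hball x _ (hs i).1))
    exact Metric.ball_subset_ball (by linarith) (hs i).1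
  · refine fun x hx => ⟨_, Metric.ball_mem_nhds x hε₁, fun s hs => ?_⟩
    exact prism_eq_zero f _ _ (Metric.ball x ε₁ ∩ A) (h₁ x hx) s hs
      fun i => by rw [hfA _ (hs i).2]; exact hs i

/-! ### Relative Mayer–Vietoris -/

theorem mem_coboundaries_of_subsingleton [TopologicalSpace X] {n : ℕ} {A : Set X}
    (h : Subsingleton (Cohomology n A)) {φ : (Fin (n + 1) → X) → ℤ} (hφ : φ ∈ cocycles n A) :
    φ ∈ coboundaries n A := by
  have h0 : ((⟨φ, hφ⟩ : cocycles n A) : Cohomology n A) = 0 := Subsingleton.elim _ _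
  exact AddSubgroup.mem_addSubgroupOf.1 ((QuotientAddGroup.eq_zero_iff _).1 h0)

/-- Cut `φ` off outside tuples in `F₂`. Near a point outside the closed set `F₂` the cut-off
vanishes, since a tuple has at least one entry. -/
theorem exists_mem_locallyZeroOn_add [TopologicalSpace X] {m : ℕ} {F₁ F₂ : Set X}
    (hF₂ : IsClosed F₂) {φ : (Fin (m + 1) → X) → ℤ} (hφ : φ ∈ locallyZeroOn (m + 1) (F₁ ∩ F₂)) :
    ∃ φ₁ ∈ locallyZeroOn (m + 1) F₁, ∃ φ₂ ∈ locallyZeroOn (m + 1) F₂, φ₁ + φ₂ = φ := by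
  classical
  refine ⟨fun s => if ∀ i, s i ∈ F₂ then φ s else 0, fun x hx => ?_,
    fun s => if ∀ i, s i ∈ F₂ then 0 else φ s,
    fun x _ => ⟨_, Filter.univ_mem, fun s hs => if_pos fun i => (hs i).2⟩, ?_⟩
  · by_cases hx₂ : x ∈ F₂
    · obtain ⟨U, hU, hU'⟩ := hφ x ⟨hx, hx₂⟩
      refine ⟨U, hU, fun s hs => ?_⟩
      dsimp only
      split_ifs with h
      · exact hU' s fun i => ⟨(hs i).1, (hs i).2, h i⟩
      · rfl
    · exact ⟨_, hF₂.isOpen_compl.mem_nhds hx₂, fun s hs => if_neg fun h => (hs 0).1 (h 0)⟩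
  · funext s
    simp only [Pi.add_apply]
    split_ifs <;> simp

/-- The interiors handle mixed tuples: near a point of `B₁` all entries lie in `F₁`, even those from
`B₂`. -/
theorem mem_locallyZeroOn_union [TopologicalSpace X] {m : ℕ} {B₁ B₂ F₁ F₂ : Set X}
    (h₁ : B₁ ⊆ interior F₁) (h₂ : B₂ ⊆ interior F₂) {φ : (Fin m → X) → ℤ}
    (hφ₁ : φ ∈ locallyZeroOn m F₁) (hφ₂ : φ ∈ locallyZeroOn m F₂) :
    φ ∈ locallyZeroOn m (B₁ ∪ B₂) := by
  have key : ∀ F, φ ∈ locallyZeroOn m F → ∀ x ∈ interior F,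
      ∃ U ∈ 𝓝 x, ∀ s : Fin m → X, (∀ i, s i ∈ U ∩ (B₁ ∪ B₂)) → φ s = 0 := by
    intro F hF x hx
    obtain ⟨U, hU, hU'⟩ := hF x (interior_subset hx)
    exact ⟨U ∩ F, Filter.inter_mem hU (mem_interior_iff_mem_nhds.1 hx),
      fun s hs => hU' s fun i => (hs i).1⟩
  rintro x (hx | hx)
  · exact key F₁ hφ₁ x (h₁ hx)
  · exact key F₂ hφ₂ x (h₂ hx)

/-- The surjectivity in the relative Mayer–Vietoris sequence, for neighbourhoods. -/
theorem cocycles_inter_le_of_subset_interior [TopologicalSpace X] {n : ℕ} {B₁ B₂ F₁ F₂ : Set X}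
    (h₁ : B₁ ⊆ interior F₁) (h₂ : B₂ ⊆ interior F₂) (hF₂ : IsClosed F₂)
    (h : Subsingleton (Cohomology (n + 1) (B₁ ∪ B₂))) :
    cocycles n (F₁ ∩ F₂) ≤ cocycles n B₁ ⊔ cocycles n B₂ := by
  rintro _ ⟨hφ, hδφ⟩
  obtain ⟨φ₁, hφ₁, φ₂, hφ₂, rfl⟩ := exists_mem_locallyZeroOn_add hF₂ hφ
  replace hδφ : coboundary (n + 1) φ₁ + coboundary (n + 1) φ₂ ∈
      locallyZeroOn (n + 2) Set.univ := by
    rw [← map_add]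
    exact hδφ
  have hδφ₁ : coboundary (n + 1) φ₁ ∈ cocycles (n + 1) (B₁ ∪ B₂) := by
    refine ⟨mem_locallyZeroOn_union h₁ h₂ (coboundary_mem_locallyZeroOn _ hφ₁) ?_, ?_⟩
    · have := sub_mem (locallyZeroOn_anti _ (Set.subset_univ F₂) hδφ)
        (coboundary_mem_locallyZeroOn _ hφ₂)
      rwa [add_sub_cancel_right] at this
    · change coboundary (n + 2) (coboundary (n + 1) φ₁) ∈ locallyZeroOn (n + 3) Set.univ
      rw [coboundary_coboundary]
      exact zero_mem _
  obtain ⟨ζ, hζ, _, ⟨ψ, hψ, rfl⟩, hsum⟩ :=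
    AddSubgroup.mem_sup.1 (mem_coboundaries_of_subsingleton h hδφ₁)
  -- Modulo locally zero functions, `ψ` has the coboundary of `φ₁`, so this correction makes both
  -- summands cocycles.
  refine AddSubgroup.mem_sup.2 ⟨φ₁ - ψ, ⟨?_, ?_⟩, φ₂ + ψ, ⟨?_, ?_⟩, by abel⟩
  · change φ₁ - ψ ∈ locallyZeroOn (n + 1) B₁
    exact sub_mem (locallyZeroOn_anti _ (h₁.trans interior_subset) hφ₁)
      (locallyZeroOn_anti _ Set.subset_union_left hψ)
  · change coboundary (n + 1) (φ₁ - ψ) ∈ locallyZeroOn (n + 2) Set.univ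
    rwa [map_sub, ← hsum, add_sub_cancel_right]
  · change φ₂ + ψ ∈ locallyZeroOn (n + 1) B₂
    exact add_mem (locallyZeroOn_anti _ (h₂.trans interior_subset) hφ₂)
      (locallyZeroOn_anti _ Set.subset_union_right hψ)
  · change coboundary (n + 1) (φ₂ + ψ) ∈ locallyZeroOn (n + 2) Set.univ
    have := sub_mem hδφ hζ
    rw [← hsum] at this
    rw [map_add]
    convert this using 1
    abel

theorem exists_closed_inter_subset [TopologicalSpace X] [NormalSpace X] {B₁ B₂ W : Set X}
    (hB₁ : IsClosed B₁) (hB₂ : IsClosed B₂) (hW : IsOpen W) (h : B₁ ∩ B₂ ⊆ W) :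
    ∃ F₁ F₂, IsClosed F₂ ∧ B₁ ⊆ interior F₁ ∧ B₂ ⊆ interior F₂ ∧ F₁ ∩ F₂ ⊆ W := by
  obtain ⟨O₁, hO₁, hBO₁, hcl₁⟩ := normal_exists_closure_subset hB₁
    (hB₂.sdiff hW).isOpen_compl fun x hx hx' => hx'.2 (h ⟨hx, hx'.1⟩)
  obtain ⟨O₂, hO₂, hBO₂, hcl₂⟩ := normal_exists_closure_subset hB₂
    ((isClosed_closure (s := O₁)).sdiff hW).isOpen_compl fun x hx hx' => hcl₁ hx'.1 ⟨hx, hx'.2⟩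
  refine ⟨closure O₁, closure O₂, isClosed_closure,
    hBO₁.trans (interior_maximal subset_closure hO₁),
    hBO₂.trans (interior_maximal subset_closure hO₂), fun x hx => ?_⟩
  by_contra hxW
  exact hcl₂ hx.2 ⟨hx.1, hxW⟩

/-- Tautness moves the class to a neighbourhood of `B₁ ∩ B₂`, where it splits. -/
theorem cocycles_inter_le_coboundaries [PseudoMetricSpace X] [CompactSpace X] {n : ℕ}
    {A B₁ B₂ : Set X} (hB₁ : IsClosed B₁) (hB₂ : IsClosed B₂) (hA : A ⊆ B₁ ∩ B₂)
    (h : Subsingleton (Cohomology (n + 1) (B₁ ∪ B₂)))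
    (h₁ : cocycles n B₁ ≤ coboundaries n A) (h₂ : cocycles n B₂ ≤ coboundaries n A) :
    cocycles n (B₁ ∩ B₂) ≤ coboundaries n A := by
  intro φ hφ
  obtain ⟨r, hr, ψ, hψ, hψφ⟩ := exists_cocycle_thickening (hB₁.inter hB₂) hφ
  obtain ⟨F₁, F₂, hF₂, hBF₁, hBF₂, hF⟩ := exists_closed_inter_subset hB₁ hB₂
    Metric.isOpen_thickening (Metric.self_subset_thickening hr (B₁ ∩ B₂))
  have hle : cocycles n (F₁ ∩ F₂) ≤ coboundaries n A :=
    (cocycles_inter_le_of_subset_interior hBF₁ hBF₂ hF₂ h).trans (sup_le h₁ h₂)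
  have hψ' : ψ ∈ coboundaries n A := hle (cocycles_anti n hF hψ)
  have hψφ' : ψ - φ ∈ coboundaries n A := coboundaries_anti n hA hψφ
  have := sub_mem hψ' hψφ'
  rwa [sub_sub_cancel] at this

theorem cocycles_biInter_le_coboundaries [PseudoMetricSpace X] [CompactSpace X] {n : ℕ}
    (h : ∀ B : Set X, IsClosed B → Subsingleton (Cohomology (n + 1) B))
    {ι : Type*} (t : Finset ι) {A : Set X} (B : ι → Set X) (hB : ∀ i ∈ t, IsClosed (B i))
    (hA : ∀ i ∈ t, A ⊆ B i) (ht : ∀ i ∈ t, cocycles n (B i) ≤ coboundaries n A) :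
    cocycles n (⋂ i ∈ t, B i) ≤ coboundaries n A := by
  classical
  induction t using Finset.induction_on with
  -- The empty intersection is the whole space, where relative cocycles are locally zero.
  | empty =>
    refine le_trans ?_ (locallyZeroOn_univ_le_coboundaries n A)
    simp only [Finset.notMem_empty, Set.iInter_of_empty, Set.iInter_univ]
    exact inf_le_left
  | insert i t _ ih =>
    simp only [Finset.forall_mem_insert] at hB hA ht
    have hcl : IsClosed (⋂ j ∈ t, B j) := isClosed_biInter hB.2
    rw [Finset.set_biInter_insert]
    exact cocycles_inter_le_coboundaries hB.1 hcl
      (Set.subset_inter hA.1 (Set.subset_iInter₂ hA.2)) (h _ (hB.1.union hcl)) ht.1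
      (ih hB.2 hA.2 ht.2)

/-! ### Locating the balls -/

theorem Cohomology.map_ne_zero_iff [TopologicalSpace X] {n : ℕ} {A B : Set X} (h : A ⊆ B) :
    Cohomology.map n h ≠ 0 ↔ ¬ cocycles n B ≤ coboundaries n A := by
  refine not_congr ⟨fun h0 φ hφ => ?_, fun hle => ?_⟩
  · have := DFunLike.congr_fun h0 (QuotientAddGroup.mk (⟨φ, hφ⟩ : cocycles n B))
    exact AddSubgroup.mem_addSubgroupOf.1 ((QuotientAddGroup.eq_zero_iff _).1 this)
  · ext x
    exact (QuotientAddGroup.eq_zero_iff _).2 (AddSubgroup.mem_addSubgroupOf.2 (hle x.2))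

theorem not_cocycles_le_coboundaries [TopologicalSpace X] {n : ℕ} {A : Set X}
    (h : Nontrivial (Cohomology n A)) : ¬ cocycles n A ≤ coboundaries n A := by
  intro hle
  obtain ⟨x, hx⟩ := exists_ne (0 : Cohomology n A)
  obtain ⟨φ, rfl⟩ := QuotientAddGroup.mk_surjective x
  exact hx ((QuotientAddGroup.eq_zero_iff _).2 (AddSubgroup.mem_addSubgroupOf.2 (hle φ.2)))

theorem exists_ball_not_cocycles_le [PseudoMetricSpace X] [CompactSpace X] {n : ℕ}
    (h : ∀ B : Set X, IsClosed B → Subsingleton (Cohomology (n + 1) B)) {A : Set X} {r ρ : ℝ}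
    (hρ : 0 < ρ) (hρr : ρ ≤ r) (hA : ¬ cocycles n (Metric.thickening r A) ≤ coboundaries n A) :
    ∃ c, (∀ a ∈ A, r ≤ dist c a) ∧ ¬ cocycles n (Metric.ball c ρ)ᶜ ≤ coboundaries n A := by
  by_contra! hc
  have hK : IsCompact (Metric.thickening r A)ᶜ := Metric.isOpen_thickening.isClosed_compl.isCompact
  obtain ⟨t, htK, ht⟩ := hK.elim_nhds_subcover (fun c => Metric.ball c ρ)
    fun c _ => Metric.ball_mem_nhds c hρ
  have hfar : ∀ c ∈ t, ∀ a ∈ A, r ≤ dist c a := fun c hct a ha => by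
    by_contra! hlt
    exact htK c hct (Metric.mem_thickening_iff.2 ⟨a, ha, hlt⟩)
  refine hA ((cocycles_anti n ?_).trans (cocycles_biInter_le_coboundaries h t
    (fun c => (Metric.ball c ρ)ᶜ) (fun c _ => Metric.isOpen_ball.isClosed_compl)
    (fun c hct a ha hac => ?_) fun c hct => hc c (hfar c hct)))
  · intro x hx
    by_contra hxr
    obtain ⟨c, hct, hxc⟩ := Set.mem_iUnion₂.1 (ht hxr)
    exact Set.mem_iInter₂.1 hx c hct hxc
  · rw [Metric.mem_ball, dist_comm] at hac
    linarith [hfar c hct a ha]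

end AlexanderSpanier

theorem lemma2p3 {Z : Type*} [MetricSpace Z] [CompactSpace Z] (n : ℕ) (A : Set Z)
    (hA : IsClosed A)
    (hn : Nontrivial (AlexanderSpanier.Cohomology n A))
    (hn1 : ∀ B : Set Z, IsClosed B → Subsingleton (AlexanderSpanier.Cohomology (n + 1) B)) :
    ∃ (k₀ : ℕ) (c : ℕ → Z) (δ : ℝ), 0 < k₀ ∧ 0 < δ ∧
      ∀ k : ℕ, k₀ ≤ k →
        (∀ x ∈ Metric.ball (c k) (1 / (k : ℝ)), ∀ a ∈ A, δ ≤ dist x a) ∧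
        ∃ hk : A ⊆ (Metric.ball (c k) (1 / (k : ℝ)))ᶜ,
          AlexanderSpanier.Cohomology.map n hk ≠ 0 := by
  obtain ⟨φ, hφ, hφA⟩ := SetLike.not_le_iff_exists.1
    (AlexanderSpanier.not_cocycles_le_coboundaries hn)
  obtain ⟨r, hr, ψ, hψ, hψφ⟩ := AlexanderSpanier.exists_cocycle_thickening hA hφ
  have hr' : ¬ AlexanderSpanier.cocycles n (Metric.thickening r A) ≤
      AlexanderSpanier.coboundaries n A := fun hle => hφA <| by
    have := sub_mem (hle hψ) hψφ
    rwa [sub_sub_cancel] at this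
  -- Centres are at distance at least `r` from `A`, so radii at most `r / 2` leave a gap `δ = r /
  -- 2`.
  obtain ⟨m, hm⟩ := exists_nat_one_div_lt (half_pos hr)
  have hk : ∀ k : ℕ, m + 1 ≤ k → 0 < 1 / (k : ℝ) ∧ 1 / (k : ℝ) ≤ r / 2 := fun k hk => by
    have hmk : (m : ℝ) + 1 ≤ k := by exact_mod_cast hk
    have hm0 : (0 : ℝ) < m + 1 := by positivity
    exact ⟨one_div_pos.2 (hm0.trans_le hmk), (one_div_le_one_div_of_le hm0 hmk).trans hm.le⟩
  have hc : ∀ k : ℕ, m + 1 ≤ k → ∃ c, (∀ a ∈ A, r ≤ dist c a) ∧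
      ¬ AlexanderSpanier.cocycles n (Metric.ball c (1 / (k : ℝ)))ᶜ ≤
        AlexanderSpanier.coboundaries n A := fun k hmk =>
    AlexanderSpanier.exists_ball_not_cocycles_le hn1 (hk k hmk).1 (by linarith [(hk k hmk).2]) hr'
  -- Supplies arbitrary centres for `k ≤ m`.
  have : Nonempty Z := ⟨(hc _ le_rfl).choose⟩
  choose! c hcA hc using hc
  refine ⟨m + 1, c, r / 2, m.succ_pos, half_pos hr, fun k hmk => ?_⟩
  have hdist : ∀ x ∈ Metric.ball (c k) (1 / (k : ℝ)), ∀ a ∈ A, r / 2 ≤ dist x a := by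
    intro x hx a ha
    rw [Metric.mem_ball, dist_comm] at hx
    linarith [dist_triangle (c k) x a, hcA k hmk a ha, (hk k hmk).2]
  refine ⟨hdist, fun a ha haB => ?_, (AlexanderSpanier.Cohomology.map_ne_zero_iff _).2 (hc k hmk)⟩
  have := hdist a haB a ha
  rw [dist_self] at this
  linarith
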